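/- Let $(R,\mathfrak m)$ be a Cohen–Macaulay (commutative Noetherian) local ring, and let $M$ be a maximal Cohen–Macaulay $R$-module, i.e. a finitely generated module with $\operatorname{depth} M=\dim M=\dim R$. For $n\ge 0$ let $\Omega_n^R(M)$ be the $n$th syzygy module of $M$, i.e. the image of the $n$th differential of an augmented minimal free resolution $\cdots\to F_1\to F_0\to M\to 0$ of $M$ (the $0$th differential being $F_0\to M$, and $F_n\to F_{n-1}$ being the $n$th for $n\ge 1$). Let $n_1,\dots,n_r\ge 1$ be integers, not necessarily distinct, and let $L\neq 0$ be an $R$-module for which there is a surjective $R$-linear map $$\bigoplus_{i=1}^{r}\Omega_{n_i}^R(M)\longrightarrow L .$$ Then $L$ is not a semidualizing $R$-module; here a finitely generated $R$-module $C$ is called semidualizing if the homothety map $R\to\operatorname{Hom}_R(C,C)$ is an isomorphism and $\operatorname{Ext}^i_R(C,C)=0$ for all $i\ge 1$. Moreover, $L$ is not free, and $L$ is not a maximal Cohen–Macaulay $R$-module of finite injective dimension. -/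

import Mathlib

open CategoryTheory DirectSum

universe u

noncomputable section

/-- The depth of a module `M` over a local ring: the supremum of the lengths of the `M`-regular
sequences contained in the maximal ideal. -/
def moduleDepth (R : Type u) [CommRing R] [IsLocalRing R]
    (M : Type u) [AddCommGroup M] [Module R M] : ℕ∞ :=
  ⨆ (rs : List R) (_ : ∀ r ∈ rs, r ∈ IsLocalRing.maximalIdeal R)
    (_ : RingTheory.Sequence.IsRegular M rs), (rs.length : ℕ∞)

/-- A Cohen-Macaulay local ring: Noetherian local with `depth R = dim R`. -/
structure IsCohenMacaulayLocal (R : Type u) [CommRing R] [IsLocalRing R] : Prop where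
  noetherian : IsNoetherianRing R
  depth_eq : (moduleDepth R R : WithBot ℕ∞) = ringKrullDim R

/-- A maximal Cohen-Macaulay module: finitely generated with `depth M = dim M = dim R`.
The zero module is excluded, since its support has dimension `⊥`. -/
structure IsMaximalCohenMacaulay (R : Type u) [CommRing R] [IsLocalRing R]
    (M : Type u) [AddCommGroup M] [Module R M] : Prop where
  finite : Module.Finite R M
  depth_eq : (moduleDepth R M : WithBot ℕ∞) = Module.supportDim R M
  dim_eq : Module.supportDim R M = ringKrullDim R

/-- A semidualizing module: finitely generated, the homothety map `R → Hom_R(M, M)` is an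
isomorphism, and `Ext^i_R(M, M) = 0` for all `i ≥ 1`. -/
structure IsSemidualizing (R : Type u) [CommRing R]
    (M : Type u) [AddCommGroup M] [Module R M] : Prop where
  finite : Module.Finite R M
  homothety_bijective : Function.Bijective (LinearMap.lsmul R M)
  ext_eq_zero : ∀ i : ℕ, 1 ≤ i →
    Subsingleton (Abelian.Ext (ModuleCat.of R M) (ModuleCat.of R M) i)

/-- Finite injective dimension. -/
def HasFiniteInjectiveDimension (R : Type u) [CommRing R]
    (M : Type u) [AddCommGroup M] [Module R M] : Prop :=
  ∃ n : ℕ, HasInjectiveDimensionLE (ModuleCat.of R M) n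

/-- An augmented minimal free resolution
`⋯ → R^(rank 2) → R^(rank 1) → R^(rank 0) → M → 0` of a module over a local ring, where
`d n : R^(rank (n + 1)) → R^(rank n)`; minimality means that every differential `d n` has image
inside the maximal ideal times its target. -/
structure MinimalFreeResolution (R : Type u) [CommRing R] [IsLocalRing R]
    (M : Type u) [AddCommGroup M] [Module R M] where
  rank : ℕ → ℕ
  d : ∀ n : ℕ, (Fin (rank (n + 1)) → R) →ₗ[R] (Fin (rank n) → R)
  aug : (Fin (rank 0) → R) →ₗ[R] M
  aug_surjective : Function.Surjective aug
  exact_aug : Function.Exact (d 0) aug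
  exact_d : ∀ n : ℕ, Function.Exact (d (n + 1)) (d n)
  minimal : ∀ n : ℕ, LinearMap.range (d n) ≤
    IsLocalRing.maximalIdeal R • (⊤ : Submodule R (Fin (rank n) → R))

/-- The `n`th syzygy module: the image of the `n`th differential of the augmented minimal free
resolution, the `0`th differential being the augmentation and the `(n + 1)`st one being `d n`. -/
def MinimalFreeResolution.syzygy {R : Type u} [CommRing R] [IsLocalRing R]
    {M : Type u} [AddCommGroup M] [Module R M] (F : MinimalFreeResolution R M) :
    ℕ → ModuleCat.{u} R
  | 0 => ModuleCat.of R (LinearMap.range F.aug)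
  | n + 1 => ModuleCat.of R (LinearMap.range (F.d n))

end

/-!
Let `k` be the residue field and choose a sequence `rs` of length `depth R` that is regular on `R`
and weakly regular on `M` and on `L`. There is an element `s` outside the ideal `(rs)` with
`s * a ∈ (rs)` for all `a` in the maximal ideal. A syzygy `Ω` of `M` of positive index lies in the
maximal ideal times a free module `F`, and `Ω / (rs)Ω` embeds into `F / (rs)F`; hence `s`
annihilates `Ω / (rs)Ω`, and therefore also `L / (rs)L`.

If `L` is free, this says `s ∈ (rs)`. If `L` is semidualizing, then `Hom(L, L) = R` and, because the
modules `Ext^i(L, L)` vanish, an endomorphism of `L` with image in `(rs)L` lies in `(rs) Hom(L, L)`;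
again `s ∈ (rs)`. If `L` has finite injective dimension, then multiplication by `s` on `R / (rs)`
factors as `R / (rs) → k → R / (rs)` and acts as zero on `Ext(R / (rs), L)` in degree `depth R`;
descending induction on `i` gives `Ext^i(A, L) = 0` for all finite `A` and all `i`, so `L = 0`.
-/

open CategoryTheory.Abelian Pointwise RingTheory.Sequence IsLocalRing

section Ext

variable {R : Type u} [CommRing R]

section ShortExact

variable {S : ShortComplex (ModuleCat.{u} R)} (hS : S.ShortExact) {i : ℕ}
include hS

theorem subsingleton_ext_X₂_covariant (X : ModuleCat.{u} R) (h₁ : Subsingleton (Ext X S.X₁ i))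
    (h₃ : Subsingleton (Ext X S.X₃ i)) : Subsingleton (Ext X S.X₂ i) := by
  refine subsingleton_of_forall_eq 0 fun e => ?_
  obtain ⟨y, rfl⟩ := Ext.covariant_sequence_exact₂ X hS e (Subsingleton.elim _ _)
  rw [Subsingleton.elim y 0, Ext.zero_comp]

theorem subsingleton_ext_X₃_covariant (X : ModuleCat.{u} R) (h₂ : Subsingleton (Ext X S.X₂ i))
    (h₁ : Subsingleton (Ext X S.X₁ (i + 1))) : Subsingleton (Ext X S.X₃ i) := by
  refine subsingleton_of_forall_eq 0 fun e => ?_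
  obtain ⟨y, rfl⟩ := Ext.covariant_sequence_exact₃ X hS e rfl (Subsingleton.elim _ _)
  rw [Subsingleton.elim y 0, Ext.zero_comp]

theorem subsingleton_ext_X₂_contravariant (Y : ModuleCat.{u} R)
    (h₁ : Subsingleton (Ext S.X₁ Y i)) (h₃ : Subsingleton (Ext S.X₃ Y i)) :
    Subsingleton (Ext S.X₂ Y i) := by
  refine subsingleton_of_forall_eq 0 fun e => ?_
  obtain ⟨y, rfl⟩ := Ext.contravariant_sequence_exact₂ hS Y e (Subsingleton.elim _ _)
  rw [Subsingleton.elim y 0, Ext.comp_zero]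

theorem exists_mk₀_f_comp_eq (Y : ModuleCat.{u} R) (h₃ : Subsingleton (Ext S.X₃ Y (i + 1)))
    (e : Ext S.X₁ Y i) : ∃ e' : Ext S.X₂ Y i, (Ext.mk₀ S.f).comp e' (zero_add i) = e :=
  Ext.contravariant_sequence_exact₁ hS Y e (add_comm 1 i) (h₃.elim _ _)

theorem eq_zero_of_mk₀_g_comp_eq_zero (Y : ModuleCat.{u} R)
    (h₁ : ∀ j < i, Subsingleton (Ext S.X₁ Y j)) (e : Ext S.X₃ Y i)
    (he : (Ext.mk₀ S.g).comp e (zero_add i) = 0) : e = 0 := by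
  cases i with
  | zero =>
    have := hS.epi_g
    obtain ⟨a, rfl⟩ := Ext.homEquiv₀.symm.surjective e
    replace he : Ext.mk₀ (S.g ≫ a) = 0 := (Ext.mk₀_comp_mk₀ S.g a).symm.trans he
    rw [Ext.mk₀_eq_zero_iff, ← Limits.comp_zero (f := S.g), cancel_epi] at he
    exact (congrArg Ext.mk₀ he).trans (Ext.mk₀_zero _ _)
  | succ i =>
    obtain ⟨y, rfl⟩ := Ext.contravariant_sequence_exact₃ hS Y e he (add_comm 1 i)
    have := h₁ i i.lt_succ_self
    rw [Subsingleton.elim y 0, Ext.comp_zero]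

end ShortExact

theorem shortExact_shortComplexOfCompEqZero {A B C : Type u} [AddCommGroup A]
    [AddCommGroup B] [AddCommGroup C] [Module R A] [Module R B] [Module R C]
    {f : A →ₗ[R] B} {g : B →ₗ[R] C} (h : Function.Exact f g) (hf : Function.Injective f)
    (hg : Function.Surjective g) :
    (ModuleCat.shortComplexOfCompEqZero f g h.linearMap_comp_eq_zero).ShortExact :=
  ModuleCat.shortComplex_shortExact _ h hf hg

theorem subsingleton_ext_prod {A B : Type u} [AddCommGroup A] [AddCommGroup B]
    [Module R A] [Module R B] {X : ModuleCat.{u} R} {i : ℕ}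
    (hA : Subsingleton (Ext X (ModuleCat.of R A) i))
    (hB : Subsingleton (Ext X (ModuleCat.of R B) i)) :
    Subsingleton (Ext X (ModuleCat.of R (A × B)) i) :=
  subsingleton_ext_X₂_covariant (shortExact_shortComplexOfCompEqZero (R := R) Function.Exact.inl_snd
    LinearMap.inl_injective LinearMap.snd_surjective) X hA hB

theorem subsingleton_ext_zero_iff {X Y : Type u} [AddCommGroup X] [AddCommGroup Y]
    [Module R X] [Module R Y] :
    Subsingleton (Ext (ModuleCat.of R X) (ModuleCat.of R Y) 0) ↔ Subsingleton (X →ₗ[R] Y) :=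
  (Ext.linearEquiv₀ (R := R).trans ModuleCat.homLinearEquiv).toEquiv.subsingleton_congr

theorem subsingleton_ext_congr {X Y : Type u} [AddCommGroup X] [AddCommGroup Y]
    [Module R X] [Module R Y] (e : X ≃ₗ[R] Y) {Z : ModuleCat.{u} R} {i : ℕ} :
    Subsingleton (Ext (ModuleCat.of R X) Z i) ↔ Subsingleton (Ext (ModuleCat.of R Y) Z i) :=
  ((forget _).mapIso
    (((extFunctor i).mapIso e.toModuleIso.op).app Z)).toEquiv.subsingleton_congr.symm

theorem smul_ext_eq_mk₀_comp {X Y : ModuleCat.{u} R} (r : R) {i : ℕ} (e : Ext X Y i) :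
    r • e = (Ext.mk₀ (r • 𝟙 X)).comp e (zero_add i) := by
  simp only [Ext.mk₀_smul, Ext.smul_comp, Ext.mk₀_id_comp]

theorem smul_ext_eq_comp_mk₀ {X Y : ModuleCat.{u} R} (r : R) {i : ℕ} (e : Ext X Y i) :
    r • e = e.comp (Ext.mk₀ (r • 𝟙 Y)) (add_zero i) := by
  simp only [Ext.mk₀_smul, Ext.comp_smul, Ext.comp_mk₀_id]

theorem smul_id_eq_zero_of_mem_annihilator {X : ModuleCat.{u} R} {r : R}
    (hr : r ∈ Module.annihilator R X) : r • 𝟙 X = 0 := by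
  ext x
  exact Module.mem_annihilator.mp hr x

theorem smul_ext_eq_zero_of_mem_annihilator_left {X Y : ModuleCat.{u} R} {r : R}
    (hr : r ∈ Module.annihilator R X) {i : ℕ} (e : Ext X Y i) : r • e = 0 := by
  rw [smul_ext_eq_mk₀_comp, smul_id_eq_zero_of_mem_annihilator hr, Ext.mk₀_zero, Ext.zero_comp]

theorem smul_ext_eq_zero_of_mem_annihilator_right {X Y : ModuleCat.{u} R} {r : R}
    (hr : r ∈ Module.annihilator R Y) {i : ℕ} (e : Ext X Y i) : r • e = 0 := by
  rw [smul_ext_eq_comp_mk₀, smul_id_eq_zero_of_mem_annihilator hr, Ext.mk₀_zero, Ext.comp_zero]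

section QuotSMulTop

variable {N : Type u} [AddCommGroup N] [Module R N] {x : R} (hx : IsSMulRegular N x)
  {X : ModuleCat.{u} R} {i : ℕ}
include hx

theorem subsingleton_ext_quotSMulTop (h₀ : Subsingleton (Ext X (ModuleCat.of R N) i))
    (h₁ : Subsingleton (Ext X (ModuleCat.of R N) (i + 1))) :
    Subsingleton (Ext X (ModuleCat.of R (QuotSMulTop x N)) i) :=
  subsingleton_ext_X₃_covariant (hx.smulShortComplex_shortExact (M := ModuleCat.of R N)) X h₀ h₁

theorem exists_ext_quotSMulTop_comp_eq (hX : x ∈ Module.annihilator R X)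
    (e : Ext X (ModuleCat.of R N) (i + 1)) :
    ∃ (e' : Ext X (ModuleCat.of R (QuotSMulTop x N)) i)
      (δ : Ext (ModuleCat.of R (QuotSMulTop x N)) (ModuleCat.of R N) 1), e'.comp δ rfl = e := by
  have hS := hx.smulShortComplex_shortExact (M := ModuleCat.of R N)
  have he : e.comp (Ext.mk₀ (x • 𝟙 (ModuleCat.of R N))) (add_zero _) = 0 := by
    rw [← smul_ext_eq_comp_mk₀, smul_ext_eq_zero_of_mem_annihilator_left hX]
  obtain ⟨e', he'⟩ := Ext.covariant_sequence_exact₁ X hS e he rfl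
  exact ⟨e', hS.extClass, he'⟩

theorem subsingleton_ext_of_quotSMulTop (hX : x ∈ Module.annihilator R X)
    (h : Subsingleton (Ext X (ModuleCat.of R (QuotSMulTop x N)) i)) :
    Subsingleton (Ext X (ModuleCat.of R N) (i + 1)) := by
  refine subsingleton_of_forall_eq 0 fun e => ?_
  obtain ⟨e', δ, rfl⟩ := exists_ext_quotSMulTop_comp_eq hx hX e
  rw [Subsingleton.elim e' 0, Ext.zero_comp]

end QuotSMulTop

theorem subsingleton_ext_of_forall_mem_annihilator {X : ModuleCat.{u} R} {N : Type u}
    [AddCommGroup N] [Module R N] {rs : List R} (hN : IsWeaklyRegular N rs)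
    (hX : ∀ r ∈ rs, r ∈ Module.annihilator R X) {i : ℕ} (hi : i < rs.length) :
    Subsingleton (Ext X (ModuleCat.of R N) i) := by
  induction rs generalizing N i with
  | nil => exact absurd hi i.not_lt_zero
  | cons x rs ih =>
    rw [isWeaklyRegular_cons_iff] at hN
    rw [List.forall_mem_cons] at hX
    cases i with
    | zero =>
      exact subsingleton_ext_zero_iff.mpr (hN.1.linearMap_subsingleton_of_mem_annihilator hX.1)
    | succ i =>
      exact subsingleton_ext_of_quotSMulTop hN.1 hX.1 (ih hN.2 hX.2 (Nat.lt_of_succ_lt_succ hi))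

theorem mkQ_mem_ofList_smul_top {N : Type*} [AddCommGroup N] [Module R N] {x : R} {rs : List R}
    {n : N} (hn : n ∈ Ideal.ofList (x :: rs) • (⊤ : Submodule R N)) :
    (x • (⊤ : Submodule R N)).mkQ n ∈ Ideal.ofList rs • (⊤ : Submodule R (QuotSMulTop x N)) := by
  have h := Submodule.mem_map_of_mem (f := (x • (⊤ : Submodule R N)).mkQ) hn
  rwa [Ideal.ofList_cons_smul, Submodule.map_sup, Submodule.map_smul'', Submodule.map_top,
    Submodule.range_mkQ, Submodule.mkQ_map_self, bot_sup_eq] at h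

theorem smul_ext_eq_zero_of_smul_mem {A : ModuleCat.{u} R} {N : Type u} [AddCommGroup N]
    [Module R N] {rs : List R} (hN : IsWeaklyRegular N rs)
    (hA : ∀ r ∈ rs, r ∈ Module.annihilator R A) {s : R}
    (hs : ∀ n : N, s • n ∈ Ideal.ofList rs • (⊤ : Submodule R N))
    (e : Ext A (ModuleCat.of R N) rs.length) : s • e = 0 := by
  induction rs generalizing N with
  | nil =>
    refine smul_ext_eq_zero_of_mem_annihilator_right (Module.mem_annihilator.mpr fun n => ?_) e
    simpa using hs n
  | cons x rs ih =>
    rw [isWeaklyRegular_cons_iff] at hN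
    obtain ⟨e', δ, rfl⟩ := exists_ext_quotSMulTop_comp_eq hN.1 (hA x List.mem_cons_self) e
    rw [← Ext.smul_comp, ih hN.2 (fun r hr => hA r (List.mem_cons_of_mem x hr)) ?_, Ext.zero_comp]
    refine (Submodule.mkQ_surjective _).forall.mpr fun n => ?_
    rw [← map_smul]
    exact mkQ_mem_ofList_smul_top (hs n)

end Ext

section RegularSequence

variable {R A B C : Type*} [CommRing R] [AddCommGroup A] [AddCommGroup B] [AddCommGroup C]
  [Module R A] [Module R B] [Module R C] {rs : List R}

theorem isWeaklyRegular_of_retract {i : A →ₗ[R] B} {p : B →ₗ[R] A} (h : p ∘ₗ i = LinearMap.id)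
    (hB : IsWeaklyRegular B rs) : IsWeaklyRegular A rs := by
  induction rs generalizing A B with
  | nil => exact IsWeaklyRegular.nil R A
  | cons r rs ih =>
    rw [isWeaklyRegular_cons_iff] at hB ⊢
    refine ⟨hB.1.of_injective i (LinearMap.injective_of_comp_eq_id i p h),
      ih (i := QuotSMulTop.map r i) (p := QuotSMulTop.map r p) ?_ hB.2⟩
    rw [← QuotSMulTop.map_comp, h, QuotSMulTop.map_id]

theorem isWeaklyRegular_pi (h : IsWeaklyRegular R rs) (n : ℕ) : IsWeaklyRegular (Fin n → R) rs :=
  ((TensorProduct.rid R (Fin n → R)).isWeaklyRegular_congr rs).mp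
    (h.isWeaklyRegular_lTensor (M₂ := Fin n → R))

theorem isWeaklyRegular_of_exact {f : A →ₗ[R] B} {g : B →ₗ[R] C} (h : Function.Exact f g)
    (hf : Function.Injective f) (hg : Function.Surjective g)
    (hB : IsWeaklyRegular B rs) (hC : IsWeaklyRegular C rs) : IsWeaklyRegular A rs := by
  induction rs generalizing A B C with
  | nil => exact IsWeaklyRegular.nil R A
  | cons r rs ih =>
    rw [isWeaklyRegular_cons_iff] at hB hC ⊢
    have hf₀ := (LinearMap.exact_zero_iff_injective PUnit f).mpr hf
    have hf' : Function.Injective (QuotSMulTop.map r f) := by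
      simpa only [map_zero, LinearMap.exact_zero_iff_injective] using
        QuotSMulTop.map_first_exact_on_four_term_exact_of_isSMulRegular_last hf₀ h hC.1
    exact ⟨hB.1.of_injective f hf, ih (QuotSMulTop.map_exact r h hg) hf'
      (QuotSMulTop.map_surjective r hg) hB.2 hC.2⟩

theorem mem_ofList_smul_top_of_exact {f : A →ₗ[R] B} {g : B →ₗ[R] C} (h : Function.Exact f g)
    (hf : Function.Injective f) (hg : Function.Surjective g) (hC : IsWeaklyRegular C rs) {a : A}
    (ha : f a ∈ Ideal.ofList rs • (⊤ : Submodule R B)) :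
    a ∈ Ideal.ofList rs • (⊤ : Submodule R A) := by
  have hf₀ := (LinearMap.exact_zero_iff_injective PUnit f).mpr hf
  have hinj := map_first_exact_on_four_term_right_exact_of_isSMulRegular_last hf₀ h hg hC
  rw [Submodule.mapQ_zero, LinearMap.exact_zero_iff_injective,
    injective_iff_map_eq_zero] at hinj
  rw [← Submodule.Quotient.mk_eq_zero] at ha ⊢
  exact hinj _ ha

theorem subtype_range_exact_rangeRestrict {f : A →ₗ[R] B} {g : B →ₗ[R] C}
    (h : Function.Exact f g) : Function.Exact (LinearMap.range f).subtype g.rangeRestrict := by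
  rw [LinearMap.exact_iff, LinearMap.ker_rangeRestrict, Submodule.range_subtype]
  exact h.linearMap_ker_eq

end RegularSequence

section Syzygy

variable {R : Type u} [CommRing R] [IsLocalRing R] {M : Type u} [AddCommGroup M] [Module R M]

namespace MinimalFreeResolution

variable (F : MinimalFreeResolution R M)

theorem exists_exact_syzygy (n : ℕ) :
    ∃ (f : F.syzygy (n + 1) →ₗ[R] (Fin (F.rank n) → R))
      (g : (Fin (F.rank n) → R) →ₗ[R] F.syzygy n),
      Function.Exact f g ∧ Function.Injective f ∧ Function.Surjective g ∧
      LinearMap.range f ≤ maximalIdeal R • (⊤ : Submodule R (Fin (F.rank n) → R)) :=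
  match n with
  | 0 => ⟨_, _, subtype_range_exact_rangeRestrict F.exact_aug, Subtype.val_injective,
      F.aug.surjective_rangeRestrict, (Submodule.range_subtype _).trans_le (F.minimal 0)⟩
  | n + 1 => ⟨_, _, subtype_range_exact_rangeRestrict (F.exact_d n), Subtype.val_injective,
      (F.d n).surjective_rangeRestrict, (Submodule.range_subtype _).trans_le (F.minimal (n + 1))⟩

variable {rs : List R} (hR : IsWeaklyRegular R rs) (hM : IsWeaklyRegular M rs)
include hR hM

theorem isWeaklyRegular_syzygy (n : ℕ) : IsWeaklyRegular (F.syzygy n) rs := by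
  induction n with
  | zero =>
    have e := LinearEquiv.ofTop _ (LinearMap.range_eq_top.mpr F.aug_surjective)
    exact (e.isWeaklyRegular_congr rs).mpr hM
  | succ n ih =>
    obtain ⟨f, g, h, hf, hg, -⟩ := F.exists_exact_syzygy n
    exact isWeaklyRegular_of_exact h hf hg (isWeaklyRegular_pi hR _) ih

theorem smul_syzygy_mem {s : R} (hs : ∀ a ∈ maximalIdeal R, s * a ∈ Ideal.ofList rs) {n : ℕ}
    (hn : 1 ≤ n) (w : F.syzygy n) : s • w ∈ Ideal.ofList rs • (⊤ : Submodule R (F.syzygy n)) := by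
  obtain ⟨n, rfl⟩ := Nat.exists_eq_add_of_le' hn
  obtain ⟨f, g, h, hf, hg, hm⟩ := F.exists_exact_syzygy n
  refine mem_ofList_smul_top_of_exact h hf hg (F.isWeaklyRegular_syzygy hR hM n) ?_
  rw [map_smul]
  refine Submodule.smul_induction_on (hm (LinearMap.mem_range_self f w)) (fun a ha v _ => ?_)
    fun v v' hv hv' => ?_
  · rw [smul_smul]
    exact Submodule.smul_mem_smul (hs a ha) trivial
  · rw [smul_add]
    exact add_mem hv hv'

theorem smul_mem_of_surjective {s : R} (hs : ∀ a ∈ maximalIdeal R, s * a ∈ Ideal.ofList rs)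
    {ι : Type*} {n : ι → ℕ} (hn : ∀ i, 1 ≤ n i) {L : Type*} [AddCommGroup L] [Module R L]
    {f : (⨁ i, F.syzygy (n i)) →ₗ[R] L} (hf : Function.Surjective f) (l : L) :
    s • l ∈ Ideal.ofList rs • (⊤ : Submodule R L) := by
  classical
  obtain ⟨w, rfl⟩ := hf l
  induction w using DirectSum.induction_on with
  | zero => simp only [map_zero, smul_zero, zero_mem]
  | of i w =>
    have h := Submodule.smul_top_le_comap_smul_top _
      (f ∘ₗ DirectSum.lof R ι (fun i => F.syzygy (n i)) i) (F.smul_syzygy_mem hR hM hs (hn i) w)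
    rwa [Submodule.mem_comap, map_smul] at h
  | add v w hv hw =>
    rw [map_add, smul_add]
    exact add_mem hv hw

end MinimalFreeResolution

end Syzygy

section Depth

variable {R : Type u} [CommRing R] [IsLocalRing R]

/-- `HasDepthGE R N t` says that `depth N ≥ t`, in homological form: `Ext^i(k, N) = 0` for all
`i < t`, where `k` is the residue field `R ⧸ maximalIdeal R` regarded as an `R`-module. It agrees
with `t ≤ moduleDepth R N` for finite nonzero `N`, and holds for every `t` if `N = 0`. -/
def HasDepthGE (R : Type u) [CommRing R] [IsLocalRing R] (N : Type u) [AddCommGroup N] [Module R N]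
    (t : ℕ) : Prop :=
  ∀ i < t, Subsingleton (Ext (ModuleCat.of R (R ⧸ maximalIdeal R)) (ModuleCat.of R N) i)

theorem support_quotient_maximalIdeal : Module.support R (R ⧸ maximalIdeal R) =
    PrimeSpectrum.zeroLocus (maximalIdeal R) := by
  rw [Module.support_eq_zeroLocus, Ideal.annihilator_quotient]

theorem maximalIdeal_smul_top_lt_top (N : Type*) [AddCommGroup N] [Module R N] [Module.Finite R N]
    [Nontrivial N] : maximalIdeal R • (⊤ : Submodule R N) < ⊤ :=
  (Submodule.top_ne_ideal_smul_of_le_jacobson_annihilator (maximalIdeal_le_jacobson _)).symm.lt_top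

theorem mem_maximalIdeal_of_isRegular {N : Type*} [AddCommGroup N] [Module R N] {rs : List R}
    (h : IsRegular N rs) {r : R} (hr : r ∈ rs) : r ∈ maximalIdeal R :=
  have hne : Ideal.ofList rs ≠ ⊤ := fun htop => h.top_ne_smul (by rw [htop, Submodule.top_smul])
  le_maximalIdeal hne (Ideal.subset_span hr)

namespace HasDepthGE

theorem prod {M N : Type u} [AddCommGroup M] [Module R M] [AddCommGroup N] [Module R N] {t : ℕ}
    (hM : HasDepthGE R M t) (hN : HasDepthGE R N t) : HasDepthGE R (M × N) t :=
  fun i hi => subsingleton_ext_prod (hM i hi) (hN i hi)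

variable {N : Type u} [AddCommGroup N] [Module R N] {t : ℕ}

theorem congr {M : Type u} [AddCommGroup M] [Module R M] (h : HasDepthGE R N t) (e : N ≃ₗ[R] M) :
    HasDepthGE R M t := fun i hi =>
  ((forget _).mapIso ((extFunctorObj (ModuleCat.of R (R ⧸ maximalIdeal R)) i).mapIso
    e.toModuleIso)).toEquiv.subsingleton_congr.mp (h i hi)

theorem of_quotSMulTop {x : R} (hxm : x ∈ maximalIdeal R) (hx : IsSMulRegular N x)
    (h : HasDepthGE R (QuotSMulTop x N) t) : HasDepthGE R N (t + 1) := by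
  have hxk : x ∈ Module.annihilator R (R ⧸ maximalIdeal R) := by rwa [Ideal.annihilator_quotient]
  intro i hi
  cases i with
  | zero =>
    exact subsingleton_ext_zero_iff.mpr (hx.linearMap_subsingleton_of_mem_annihilator hxk)
  | succ i => exact subsingleton_ext_of_quotSMulTop hx hxk (h i (Nat.lt_of_succ_lt_succ hi))

end HasDepthGE

theorem hasDepthGE_of_le_moduleDepth {N : Type u} [AddCommGroup N] [Module R N] {t : ℕ}
    (h : (t : ℕ∞) ≤ moduleDepth R N) : HasDepthGE R N t := by
  intro i hi
  obtain ⟨rs, hm, hreg, hlt⟩ : ∃ rs : List R, (∀ r ∈ rs, r ∈ maximalIdeal R) ∧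
      IsRegular N rs ∧ (i : ℕ∞) < rs.length := by
    simpa only [moduleDepth, lt_iSup_iff, exists_prop] using
      (Nat.cast_lt.mpr hi).trans_le h
  refine subsingleton_ext_of_forall_mem_annihilator hreg.toIsWeaklyRegular (fun r hr => ?_)
    (Nat.cast_lt.mp hlt)
  exact (maximalIdeal R).annihilator_quotient.ge (hm r hr)

variable [IsNoetherianRing R] {N : Type u} [AddCommGroup N] [Module R N] [Module.Finite R N]

theorem moduleDepth_le_ringKrullDim : moduleDepth R N ≤ ringKrullDim R := by
  obtain ⟨d, hd⟩ := WithBot.ne_bot_iff_exists.mp (ringKrullDim_ne_bot (R := R))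
  rw [← hd, WithBot.coe_le_coe]
  refine iSup_le fun rs => iSup_le fun _ => iSup_le fun hreg => WithBot.coe_le_coe.mp ?_
  have := hreg.quot_ofList_smul_nontrivial ⊤
  calc ((rs.length : ℕ∞) : WithBot ℕ∞)
    _ ≤ Module.supportDim R (N ⧸ Ideal.ofList rs • (⊤ : Submodule R N)) + rs.length :=
      le_add_of_nonneg_left (Order.krullDim_nonneg_iff.mpr
        Module.nonempty_support_of_nontrivial.to_subtype)
    _ = Module.supportDim R N := Module.supportDim_add_length_eq_supportDim_of_isRegular rs hreg
    _ ≤ ringKrullDim R := Module.supportDim_le_ringKrullDim R N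
    _ = d := hd.symm

theorem moduleDepth_ne_top : moduleDepth R N ≠ ⊤ := by
  intro h
  have hle := moduleDepth_le_ringKrullDim (R := R) (N := N)
  rw [h, WithBot.coe_top, top_le_iff] at hle
  exact ringKrullDim_ne_top hle

namespace HasDepthGE

theorem exists_isSMulRegular {t : ℕ} (h : HasDepthGE R N (t + 1)) :
    ∃ x ∈ maximalIdeal R, IsSMulRegular N x := by
  simpa only [Ideal.annihilator_quotient] using
    IsSMulRegular.subsingleton_linearMap_iff.mp (subsingleton_ext_zero_iff.mp (h 0 t.succ_pos))

theorem exists_isRegular [Nontrivial N] {t : ℕ} (h : HasDepthGE R N t) :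
    ∃ rs : List R, rs.length = t ∧ IsRegular N rs := by
  obtain ⟨rs, hl, -, hreg⟩ := ModuleCat.exists_isRegular_of_exists_subsingleton_ext _ t
    (ModuleCat.of R N) (maximalIdeal_smul_top_lt_top N) _ support_quotient_maximalIdeal h
  exact ⟨rs, hl, hreg⟩

/-- `R × M × N` has depth at least `t`, and a regular sequence on it is weakly regular on each
factor. -/
theorem exists_isWeaklyRegular {M : Type u} [AddCommGroup M] [Module R M] [Module.Finite R M]
    {t : ℕ} (hR : HasDepthGE R R t) (hM : HasDepthGE R M t) (hN : HasDepthGE R N t) :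
    ∃ rs : List R,
      rs.length = t ∧ IsRegular R rs ∧ IsWeaklyRegular M rs ∧ IsWeaklyRegular N rs := by
  obtain ⟨rs, hl, h⟩ := (hR.prod (hM.prod hN)).exists_isRegular
  have hR := isWeaklyRegular_of_retract (LinearMap.fst_comp_inl R R (M × N)) h.toIsWeaklyRegular
  have hMN := isWeaklyRegular_of_retract (LinearMap.snd_comp_inr R R (M × N)) h.toIsWeaklyRegular
  exact ⟨rs, hl,
    .of_isWeaklyRegular_of_mem_maximalIdeal R (fun _ hr => mem_maximalIdeal_of_isRegular h hr) hR,
    isWeaklyRegular_of_retract (LinearMap.fst_comp_inl R M N) hMN,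
    isWeaklyRegular_of_retract (LinearMap.snd_comp_inr R M N) hMN⟩

end HasDepthGE

end Depth

section Socle

variable {R : Type u} [CommRing R] [IsLocalRing R]

/-- An element of `R` that lies outside the ideal `(rs)` and whose class generates a copy of the
residue field in `R ⧸ (rs)`, that is, a nonzero element of the socle of `R ⧸ (rs)`. -/
structure IsSocleElement (rs : List R) (s : R) : Prop where
  notMem : s ∉ Ideal.ofList rs
  mul_mem : ∀ a ∈ maximalIdeal R, s * a ∈ Ideal.ofList rs

theorem IsSocleElement.ofList_le_maximalIdeal {rs : List R} {s : R} (hs : IsSocleElement rs s) :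
    Ideal.ofList rs ≤ maximalIdeal R :=
  le_maximalIdeal fun h => hs.notMem (h ▸ Submodule.mem_top)

theorem IsSocleElement.exists_comp_eq_smul_id {rs : List R} {s : R} (hs : IsSocleElement rs s) :
    ∃ (f : (R ⧸ maximalIdeal R) →ₗ[R] (R ⧸ Ideal.ofList rs))
      (q : (R ⧸ Ideal.ofList rs) →ₗ[R] (R ⧸ maximalIdeal R)),
      Function.Injective f ∧ Function.Surjective q ∧ f ∘ₗ q = s • LinearMap.id := by
  have : IsSimpleModule R (R ⧸ maximalIdeal R) :=
    isSimpleModule_iff_isCoatom.mpr (maximalIdeal.isMaximal R).out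
  let f := (maximalIdeal R).mapQ (Ideal.ofList rs) (LinearMap.lsmul R R s) hs.mul_mem
  have hf : f ≠ 0 := fun h => hs.notMem <| by
    have h1 : (Submodule.Quotient.mk (s * 1) : R ⧸ Ideal.ofList rs) = 0 :=
      LinearMap.congr_fun h (Submodule.Quotient.mk 1)
    rwa [mul_one, Submodule.Quotient.mk_eq_zero] at h1
  refine ⟨f, Submodule.factor hs.ofList_le_maximalIdeal, LinearMap.injective_of_ne_zero hf,
    Submodule.factor_surjective hs.ofList_le_maximalIdeal, ?_⟩
  ext
  rfl

variable [IsNoetherianRing R]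

theorem exists_linearMap_ne_zero_of_isRegular {N : Type u} [AddCommGroup N] [Module R N]
    [Module.Finite R N] {rs : List R} (hreg : IsRegular N rs)
    (hlen : moduleDepth R N = rs.length) :
    ∃ g : (R ⧸ maximalIdeal R) →ₗ[R] (N ⧸ Ideal.ofList rs • (⊤ : Submodule R N)), g ≠ 0 := by
  by_contra! h
  -- Otherwise some `x` in the maximal ideal is regular on `N ⧸ (rs) N`, and `rs ++ [x]` is longer.
  obtain ⟨x, hxm, hx⟩ := IsSMulRegular.subsingleton_linearMap_iff.mp
    (subsingleton_of_forall_eq 0 h)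
  rw [Ideal.annihilator_quotient] at hxm
  have hmem : ∀ r ∈ rs ++ [x], r ∈ maximalIdeal R :=
    List.forall_mem_append.mpr
      ⟨fun _ hr => mem_maximalIdeal_of_isRegular hreg hr, List.forall_mem_singleton.mpr hxm⟩
  have hweak : IsWeaklyRegular N (rs ++ [x]) := (isWeaklyRegular_append_iff N rs [x]).mpr
    ⟨hreg.toIsWeaklyRegular, (isWeaklyRegular_singleton_iff _ x).mpr hx⟩
  have := hreg.nontrivial
  have hle : ((rs ++ [x]).length : ℕ∞) ≤ moduleDepth R N :=
    le_iSup_of_le _ <| le_iSup_of_le hmem <|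
      le_iSup_of_le (.of_isWeaklyRegular_of_mem_maximalIdeal N hmem hweak) le_rfl
  rw [hlen, Nat.cast_le, List.length_append, List.length_singleton] at hle
  exact hle.not_gt (Nat.lt_succ_self _)

theorem exists_isSocleElement {rs : List R} (hreg : IsRegular R rs)
    (hlen : moduleDepth R R = rs.length) : ∃ s, IsSocleElement rs s := by
  obtain ⟨g, hg⟩ := exists_linearMap_ne_zero_of_isRegular hreg hlen
  obtain ⟨s, hs⟩ := Submodule.mkQ_surjective _ (g 1)
  have hmul (a : R) : a * s ∈ Ideal.ofList rs ↔ g (Submodule.Quotient.mk a) = 0 := by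
    have ha : (Submodule.Quotient.mk a : R ⧸ maximalIdeal R) = a • 1 :=
      Algebra.algebraMap_eq_smul_one a
    rw [ha, map_smul, ← hs, ← map_smul, Submodule.mkQ_apply, Submodule.Quotient.mk_eq_zero]
    simp only [smul_eq_mul, Ideal.mul_top]
  refine ⟨s, fun hmem => hg ?_, fun a ha => ?_⟩
  · ext
    exact (hmul 1).mp (by rwa [one_mul])
  · rw [mul_comm, hmul, (Submodule.Quotient.mk_eq_zero _).mpr ha, map_zero]

end Socle

section Hom

variable {R : Type u} [CommRing R] {C N : Type u} [AddCommGroup C] [AddCommGroup N]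
  [Module R C] [Module R N]

theorem compRight_mkQ_surjective_of_subsingleton_ext {x : R} (hx : IsSMulRegular N x)
    (h : Subsingleton (Ext (ModuleCat.of R C) (ModuleCat.of R N) 1)) :
    Function.Surjective (LinearMap.compRight R (M := C) (x • (⊤ : Submodule R N)).mkQ) := by
  intro g
  obtain ⟨y, hy⟩ := Ext.covariant_sequence_exact₃ (ModuleCat.of R C)
    (hx.smulShortComplex_shortExact (M := ModuleCat.of R N))
    (Ext.mk₀ (ModuleCat.ofHom g)) (zero_add 1) (h.elim _ _)
  obtain ⟨y, rfl⟩ := Ext.homEquiv₀.symm.surjective y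
  have hlift := (Ext.mk₀_bijective _ _).injective ((Ext.mk₀_comp_mk₀ _ _).symm.trans hy)
  exact ⟨y.hom, congrArg ModuleCat.Hom.hom hlift⟩

theorem exact_compRight_of_injective {R P A B C : Type*} [CommRing R] [AddCommGroup P]
    [AddCommGroup A] [AddCommGroup B] [AddCommGroup C] [Module R P] [Module R A] [Module R B]
    [Module R C] {f : A →ₗ[R] B} {g : B →ₗ[R] C} (h : Function.Exact f g)
    (hf : Function.Injective f) :
    Function.Exact (LinearMap.compRight R (M := P) f) (LinearMap.compRight R (M := P) g) := by
  refine fun φ => ⟨fun hφ => ?_, ?_⟩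
  · have hrange (p : P) : φ p ∈ LinearMap.range f := (h (φ p)).mp (LinearMap.congr_fun hφ p)
    refine ⟨(LinearEquiv.ofInjective f hf).symm ∘ₗ φ.codRestrict _ hrange, ?_⟩
    ext p
    exact congrArg Subtype.val ((LinearEquiv.ofInjective f hf).apply_symm_apply ⟨φ p, hrange p⟩)
  · rintro ⟨ψ, rfl⟩
    ext p
    exact h.apply_apply_eq_zero (ψ p)

theorem exact_lsmul_compRight_mkQ {R P N : Type*} [CommRing R] [AddCommGroup P] [AddCommGroup N]
    [Module R P] [Module R N] {x : R} (hx : IsSMulRegular N x) :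
    Function.Exact (LinearMap.lsmul R (P →ₗ[R] N) x)
      (LinearMap.compRight R (M := P) (x • (⊤ : Submodule R N)).mkQ) :=
  exact_compRight_of_injective (LinearMap.exact_lsmul_mkQ_smul_top N x) hx

theorem mem_ofList_smul_top_of_forall_apply_mem {rs : List R} (hN : IsWeaklyRegular N rs)
    (h : ∀ i, 1 ≤ i → Subsingleton (Ext (ModuleCat.of R C) (ModuleCat.of R N) i))
    (g : C →ₗ[R] N) (hg : ∀ c, g c ∈ Ideal.ofList rs • (⊤ : Submodule R N)) :
    g ∈ Ideal.ofList rs • (⊤ : Submodule R (C →ₗ[R] N)) := by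
  induction rs generalizing N with
  | nil =>
    have : g = 0 := by
      ext c
      simpa using hg c
    simp [this]
  | cons x rs ih =>
    rw [isWeaklyRegular_cons_iff] at hN
    let π := LinearMap.compRight R (M := C) (x • (⊤ : Submodule R N)).mkQ
    have hπ : Function.Surjective π :=
      compRight_mkQ_surjective_of_subsingleton_ext hN.1 (h 1 le_rfl)
    have hmem : π g ∈ Ideal.ofList rs • ⊤ :=
      ih hN.2 (fun i hi => subsingleton_ext_quotSMulTop hN.1 (h i hi)
        (h (i + 1) (hi.trans i.le_succ))) (π g) fun c => mkQ_mem_ofList_smul_top (hg c)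
    rw [← LinearMap.range_eq_top.mpr hπ, ← Submodule.map_top, ← Submodule.map_smul''] at hmem
    obtain ⟨g', hg', hgg'⟩ := hmem
    obtain ⟨e, he⟩ := (exact_lsmul_compRight_mkQ hN.1 (g - g')).mp (by
      rw [map_sub, hgg', sub_self])
    rw [Ideal.ofList_cons_smul, ← sub_add_cancel g g', ← he]
    exact Submodule.add_mem_sup (Submodule.smul_mem_pointwise_smul _ _ _ Submodule.mem_top) hg'

end Hom

section ResidueField

variable {R : Type*} [CommRing R] [IsLocalRing R]

theorem exists_surjective_residueField (C : Type*) [AddCommGroup C] [Module R C]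
    [Module.Finite R C] [Nontrivial C] :
    ∃ q : C →ₗ[R] (R ⧸ maximalIdeal R), Function.Surjective q := by
  obtain ⟨K, hK, -⟩ := (eq_top_or_exists_le_coatom (⊥ : Submodule R C)).resolve_left bot_ne_top
  obtain ⟨I, hI, ⟨e⟩⟩ := isSimpleModule_iff_quot_maximal.mp (isSimpleModule_iff_isCoatom.mpr hK)
  rw [eq_maximalIdeal hI] at e
  exact ⟨e.toLinearMap ∘ₗ K.mkQ, e.surjective.comp K.mkQ_surjective⟩

theorem subsingleton_linearMap_residueField {C N : Type*} [AddCommGroup C] [AddCommGroup N]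
    [Module R C] [Module R N] [Module.Finite R C] [Nontrivial C] {x : R} (hxm : x ∈ maximalIdeal R)
    (hx : IsSMulRegular (C →ₗ[R] N) x) : Subsingleton ((R ⧸ maximalIdeal R) →ₗ[R] N) := by
  obtain ⟨q, hq⟩ := exists_surjective_residueField (R := R) C
  refine subsingleton_of_forall_eq 0 fun g => (LinearMap.cancel_right hq).mp (hx ?_)
  have hxk : x ∈ Module.annihilator R (R ⧸ maximalIdeal R) := by rwa [Ideal.annihilator_quotient]
  ext c
  simp [← map_smul, Module.mem_annihilator.mp hxk]

end ResidueField

section Semidualizing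

variable {R : Type u} [CommRing R]

theorem mem_of_forall_smul_mem_of_free {R L : Type*} [CommRing R] [AddCommGroup L] [Module R L]
    [Nontrivial L] [Module.Free R L] {I : Ideal R} {s : R}
    (h : ∀ l : L, s • l ∈ I • (⊤ : Submodule R L)) : s ∈ I := by
  let b := Module.Free.chooseBasis R L
  obtain ⟨i⟩ := b.index_nonempty
  have hcoord := Submodule.smul_top_le_comap_smul_top I (b.coord i) (h (b i))
  simpa using hcoord

theorem IsSemidualizing.mem_of_forall_smul_mem {L : Type u} [AddCommGroup L] [Module R L]
    (hL : IsSemidualizing R L) {rs : List R} (hrs : IsWeaklyRegular L rs) {s : R}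
    (hs : ∀ l : L, s • l ∈ Ideal.ofList rs • (⊤ : Submodule R L)) : s ∈ Ideal.ofList rs := by
  let e := LinearEquiv.ofBijective (LinearMap.lsmul R L) hL.homothety_bijective
  have h := mem_ofList_smul_top_of_forall_apply_mem hrs hL.ext_eq_zero (e s) hs
  simpa using Submodule.smul_top_le_comap_smul_top (Ideal.ofList rs) e.symm.toLinearMap h

variable [IsLocalRing R] [IsNoetherianRing R]

theorem HasDepthGE.of_linearMap {C N : Type u} [AddCommGroup C] [AddCommGroup N]
    [Module R C] [Module R N] [Module.Finite R C] [Nontrivial C] [Module.Finite R N]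
    (h : ∀ i, 1 ≤ i → Subsingleton (Ext (ModuleCat.of R C) (ModuleCat.of R N) i)) {t : ℕ}
    (ht : HasDepthGE R (C →ₗ[R] N) t) : HasDepthGE R N t := by
  induction t generalizing N with
  | zero => exact fun i hi => absurd hi i.not_lt_zero
  | succ t ih =>
    obtain ⟨y, hym, hy⟩ := ht.exists_isSMulRegular
    obtain ⟨x, hxm, hx⟩ := IsSMulRegular.subsingleton_linearMap_iff.mp
      (subsingleton_linearMap_residueField hym hy)
    rw [Ideal.annihilator_quotient] at hxm
    have hHom := shortExact_shortComplexOfCompEqZero (exact_lsmul_compRight_mkQ (P := C) hx)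
      (fun f g hfg => LinearMap.ext fun c => hx (LinearMap.congr_fun hfg c))
      (compRight_mkQ_surjective_of_subsingleton_ext hx (h 1 le_rfl))
    refine .of_quotSMulTop hxm hx (ih (fun i hi => ?_) fun i hi => ?_)
    · exact subsingleton_ext_quotSMulTop hx (h i hi) (h (i + 1) (hi.trans i.le_succ))
    · exact subsingleton_ext_X₃_covariant hHom _ (ht i (hi.trans t.lt_succ_self))
        (ht (i + 1) (Nat.succ_lt_succ hi))

theorem IsSemidualizing.hasDepthGE {L : Type u} [AddCommGroup L] [Module R L] [Nontrivial L]
    (hL : IsSemidualizing R L) {t : ℕ} (ht : HasDepthGE R R t) : HasDepthGE R L t := by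
  have := hL.finite
  exact .of_linearMap hL.ext_eq_zero
    (ht.congr (LinearEquiv.ofBijective (LinearMap.lsmul R L) hL.homothety_bijective))

end Semidualizing

section FiniteInjectiveDimension

variable {R : Type u} [CommRing R] [IsLocalRing R] [IsNoetherianRing R]

theorem subsingleton_ext_quotient_ofList {rs : List R} (hreg : IsRegular R rs)
    (Y : ModuleCat.{u} R) {i : ℕ} (hi : rs.length < i) :
    Subsingleton (Ext (ModuleCat.of R (R ⧸ Ideal.ofList rs)) Y i) := by
  have := (projectiveDimension_le_iff _ _).mp
    (ModuleCat.projectiveDimension_quotient_eq_length.{u} rs hreg).le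
  have := hasProjectiveDimensionLT_of_iso
    (Shrink.linearEquiv R (R ⧸ Ideal.ofList rs)).toModuleIso (rs.length + 1)
  exact HasProjectiveDimensionLT.subsingleton _ (rs.length + 1) i hi _

variable {L : Type u} [AddCommGroup L] [Module R L]

theorem IsSocleElement.subsingleton_ext_residueField {rs : List R}
    (hreg : IsRegular R rs) {s : R} (hs : IsSocleElement rs s) (hrsL : IsWeaklyRegular L rs)
    (hsL : ∀ l : L, s • l ∈ Ideal.ofList rs • (⊤ : Submodule R L)) {n : ℕ}
    (hsucc : ∀ (A : Type u) [AddCommGroup A] [Module R A] [Module.Finite R A],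
      Subsingleton (Ext (ModuleCat.of R A) (ModuleCat.of R L) (n + 1))) :
    Subsingleton (Ext (ModuleCat.of R (R ⧸ maximalIdeal R)) (ModuleCat.of R L) n) := by
  obtain ⟨f, q, hf, hq, hfq⟩ := hs.exists_comp_eq_smul_id
  obtain hn | hn := lt_or_ge n rs.length
  · refine subsingleton_ext_of_forall_mem_annihilator hrsL (fun r hr => ?_) hn
    exact (maximalIdeal R).annihilator_quotient.ge
      (hs.ofList_le_maximalIdeal (Ideal.subset_span hr))
  refine subsingleton_of_forall_eq 0 fun e => ?_
  obtain ⟨e', he'⟩ : ∃ e', (Ext.mk₀ (ModuleCat.ofHom f)).comp e' (zero_add n) = e :=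
    exists_mk₀_f_comp_eq (shortExact_shortComplexOfCompEqZero f.exact_map_mkQ_range hf
      (LinearMap.range f).mkQ_surjective) _ (hsucc _) e
  obtain rfl | hn := hn.eq_or_lt
  · -- The pull-back of `e` along `q` is `s` times an extension of `e` along `f`, hence zero.
    have hmem (r : R) (hr : r ∈ rs) : r ∈ Module.annihilator R (R ⧸ Ideal.ofList rs) :=
      (Ideal.ofList rs).annihilator_quotient.ge (Ideal.subset_span hr)
    have hqe : (Ext.mk₀ (ModuleCat.ofHom q)).comp e (zero_add _) = 0 := by
      calc (Ext.mk₀ (ModuleCat.ofHom q)).comp e (zero_add _)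
        _ = (Ext.mk₀ (ModuleCat.ofHom (f ∘ₗ q))).comp e' (zero_add _) := by
          rw [← he', Ext.mk₀_comp_mk₀_assoc, ModuleCat.ofHom_comp]
        _ = s • e' := by
          rw [hfq, smul_ext_eq_mk₀_comp]
          rfl
        _ = 0 := smul_ext_eq_zero_of_smul_mem hrsL hmem hsL e'
    refine eq_zero_of_mk₀_g_comp_eq_zero (shortExact_shortComplexOfCompEqZero
      q.exact_subtype_ker_map (LinearMap.ker q).subtype_injective hq) _ (fun j hj => ?_) e hqe
    refine subsingleton_ext_of_forall_mem_annihilator hrsL (fun r hr => ?_) hj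
    exact LinearMap.annihilator_le_of_injective _ (LinearMap.ker q).subtype_injective (hmem r hr)
  · have := subsingleton_ext_quotient_ofList hreg (ModuleCat.of R L) hn
    rw [← he', Subsingleton.elim e' 0, Ext.comp_zero]

variable [Module.Finite R L]

theorem subsingleton_ext_of_succ_quotSMulTop {A : Type u} [AddCommGroup A] [Module R A]
    [Module.Finite R A] {x : R} (hxm : x ∈ maximalIdeal R) (hx : IsSMulRegular A x) {n : ℕ}
    (h : Subsingleton (Ext (ModuleCat.of R (QuotSMulTop x A)) (ModuleCat.of R L) (n + 1))) :
    Subsingleton (Ext (ModuleCat.of R A) (ModuleCat.of R L) n) := by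
  by_contra! hE
  refine Submodule.top_ne_pointwise_smul_of_mem_jacobson_annihilator
    (maximalIdeal_le_jacobson (Module.annihilator R (Ext (ModuleCat.of R A) (ModuleCat.of R L) n))
      hxm) (top_unique fun e _ => ?_).symm
  obtain ⟨e', he'⟩ : ∃ e' : Ext (ModuleCat.of R A) (ModuleCat.of R L) n,
      (Ext.mk₀ (x • 𝟙 (ModuleCat.of R A))).comp e' (zero_add n) = e :=
    exists_mk₀_f_comp_eq (hx.smulShortComplex_shortExact (M := ModuleCat.of R A)) _ h e
  rw [← he', ← smul_ext_eq_mk₀_comp]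
  exact Submodule.smul_mem_pointwise_smul e' x ⊤ trivial

theorem subsingleton_ext_of_residueField {n : ℕ}
    (hk : Subsingleton (Ext (ModuleCat.of R (R ⧸ maximalIdeal R)) (ModuleCat.of R L) n))
    (hsucc : ∀ (A : Type u) [AddCommGroup A] [Module R A] [Module.Finite R A],
      Subsingleton (Ext (ModuleCat.of R A) (ModuleCat.of R L) (n + 1)))
    (A : Type u) [AddCommGroup A] [Module R A] [hA : Module.Finite R A] :
    Subsingleton (Ext (ModuleCat.of R A) (ModuleCat.of R L) n) := by
  induction hA using IsNoetherianRing.induction_on_isQuotientEquivQuotientPrime R with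
  | subsingleton A =>
    refine subsingleton_of_forall_eq 0 fun e => ?_
    have h1 : (1 : R) ∈ Module.annihilator R A := by
      rw [Module.annihilator_eq_top_iff.mpr ‹_›]
      trivial
    rw [← one_smul R e, smul_ext_eq_zero_of_mem_annihilator_left h1]
  | quotient A p e =>
    rw [subsingleton_ext_congr e]
    by_cases hp : maximalIdeal R ≤ p.asIdeal
    · rwa [← (maximalIdeal.isMaximal R).eq_of_le p.isPrime.ne_top hp]
    obtain ⟨x, hxm, hxp⟩ := SetLike.not_le_iff_exists.mp hp
    have hx : IsSMulRegular (R ⧸ p.asIdeal) x :=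
      (isSMulRegular_quotient_iff_mem_of_smul_mem _ _).mpr fun y hy =>
        (p.isPrime.mem_or_mem hy).resolve_left hxp
    exact subsingleton_ext_of_succ_quotSMulTop hxm hx (hsucc _)
  | exact A B C f g hf hg hfg hA hC =>
    exact subsingleton_ext_X₂_contravariant (shortExact_shortComplexOfCompEqZero hfg hf hg) _ hA hC

theorem HasFiniteInjectiveDimension.subsingleton_ext (hL : HasFiniteInjectiveDimension R L)
    (hk : ∀ n, (∀ (A : Type u) [AddCommGroup A] [Module R A] [Module.Finite R A],
      Subsingleton (Ext (ModuleCat.of R A) (ModuleCat.of R L) (n + 1))) →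
      Subsingleton (Ext (ModuleCat.of R (R ⧸ maximalIdeal R)) (ModuleCat.of R L) n)) (n : ℕ)
    (A : Type u) [AddCommGroup A] [Module R A] [Module.Finite R A] :
    Subsingleton (Ext (ModuleCat.of R A) (ModuleCat.of R L) n) := by
  obtain ⟨N, hN⟩ := hL
  obtain h | h := le_total (N + 1) n
  · exact HasInjectiveDimensionLT.subsingleton _ (N + 1) n h _
  induction h using Nat.decreasingInduction generalizing A with
  | self => exact HasInjectiveDimensionLT.subsingleton _ (N + 1) _ le_rfl _
  | of_succ n _ ih => exact subsingleton_ext_of_residueField (hk n ih) ih A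

theorem IsSocleElement.subsingleton_of_hasFiniteInjectiveDimension {rs : List R}
    (hreg : IsRegular R rs) {s : R} (hs : IsSocleElement rs s) (hrsL : IsWeaklyRegular L rs)
    (hsL : ∀ l : L, s • l ∈ Ideal.ofList rs • (⊤ : Submodule R L))
    (hL : HasFiniteInjectiveDimension R L) : Subsingleton L := by
  have h := subsingleton_ext_zero_iff.mp <| hL.subsingleton_ext
    (fun _ => hs.subsingleton_ext_residueField hreg hrsL hsL) 0 R
  exact (LinearMap.ringLmapEquivSelf R R L).symm.toEquiv.subsingleton_congr.mpr h

end FiniteInjectiveDimension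

section Main

variable {R : Type u} [CommRing R] [IsLocalRing R]

theorem IsMaximalCohenMacaulay.moduleDepth_eq {M : Type u} [AddCommGroup M] [Module R M]
    (hM : IsMaximalCohenMacaulay R M) (hR : IsCohenMacaulayLocal R) :
    moduleDepth R M = moduleDepth R R := by
  exact_mod_cast hM.depth_eq.trans (hM.dim_eq.trans hR.depth_eq.symm)

variable [IsNoetherianRing R] {M : Type u} [AddCommGroup M] [Module R M]

theorem MinimalFreeResolution.exists_isSocleElement_smul_mem (F : MinimalFreeResolution R M)
    {d : ℕ} (hd : moduleDepth R R = d) (hM : HasDepthGE R M d) {N : Type u} [AddCommGroup N]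
    [Module R N] [Module.Finite R N] (hN : HasDepthGE R N d) {ι : Type*} {n : ι → ℕ}
    (hn : ∀ i, 1 ≤ n i) {L : Type u} [AddCommGroup L] [Module R L]
    {f : (⨁ i, F.syzygy (n i)) →ₗ[R] L} (hf : Function.Surjective f) :
    ∃ (rs : List R) (s : R), IsRegular R rs ∧ IsWeaklyRegular N rs ∧ IsSocleElement rs s ∧
      ∀ l : L, s • l ∈ Ideal.ofList rs • (⊤ : Submodule R L) := by
  have := Module.Finite.of_surjective F.aug F.aug_surjective
  obtain ⟨rs, rfl, hrs, hrsM, hrsN⟩ :=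
    (hasDepthGE_of_le_moduleDepth hd.ge).exists_isWeaklyRegular hM hN
  obtain ⟨s, hs⟩ := exists_isSocleElement hrs hd
  exact ⟨rs, s, hrs, hrsN, hs,
    F.smul_mem_of_surjective hrs.toIsWeaklyRegular hrsM hs.mul_mem hn hf⟩

theorem theorem3p3_general (hM : moduleDepth R R ≤ moduleDepth R M)
    (F : MinimalFreeResolution R M) {ι : Type*} (n : ι → ℕ) (hn : ∀ i, 1 ≤ n i)
    {L : Type u} [AddCommGroup L] [Module R L] [Nontrivial L]
    (f : (⨁ i, F.syzygy (n i)) →ₗ[R] L) (hf : Function.Surjective f) :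
    ¬ IsSemidualizing R L ∧
      ¬ Module.Free R L ∧
      ¬ (Module.Finite R L ∧ moduleDepth R R ≤ moduleDepth R L ∧
        HasFiniteInjectiveDimension R L) := by
  obtain ⟨d, hd⟩ := ENat.ne_top_iff_exists.mp (moduleDepth_ne_top (R := R) (N := R))
  have hR := hasDepthGE_of_le_moduleDepth hd.le
  have hMd := hasDepthGE_of_le_moduleDepth (hd.trans_le hM)
  refine ⟨fun hL => ?_, fun _ => ?_, fun ⟨_, hLd, hinj⟩ => ?_⟩
  · have := hL.finite
    obtain ⟨rs, s, -, hrs, hs, hsL⟩ :=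
      F.exists_isSocleElement_smul_mem hd.symm hMd (hL.hasDepthGE hR) hn hf
    exact hs.notMem (hL.mem_of_forall_smul_mem hrs hsL)
  · obtain ⟨rs, s, -, -, hs, hsL⟩ := F.exists_isSocleElement_smul_mem hd.symm hMd hR hn hf
    exact hs.notMem (mem_of_forall_smul_mem_of_free hsL)
  · have hLd := hasDepthGE_of_le_moduleDepth (hd.trans_le hLd)
    obtain ⟨rs, s, hreg, hrs, hs, hsL⟩ := F.exists_isSocleElement_smul_mem hd.symm hMd hLd hn hf
    exact not_subsingleton L (hs.subsingleton_of_hasFiniteInjectiveDimension hreg hrs hsL hinj)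

end Main

theorem theorem3p3 {R : Type u} [CommRing R] [IsLocalRing R] (hR : IsCohenMacaulayLocal R)
    {M : Type u} [AddCommGroup M] [Module R M] (hM : IsMaximalCohenMacaulay R M)
    (F : MinimalFreeResolution R M)
    {r : ℕ} (n : Fin r → ℕ) (hn : ∀ i, 1 ≤ n i)
    {L : Type u} [AddCommGroup L] [Module R L] [Nontrivial L]
    (f : (⨁ i : Fin r, F.syzygy (n i)) →ₗ[R] L) (hf : Function.Surjective f) :
    ¬ IsSemidualizing R L ∧
      ¬ Module.Free R L ∧
      ¬ (IsMaximalCohenMacaulay R L ∧ HasFiniteInjectiveDimension R L) := by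
  have := hR.noetherian
  obtain ⟨hsd, hfree, hinj⟩ := theorem3p3_general (hM.moduleDepth_eq hR).ge F n hn f hf
  exact ⟨hsd, hfree, fun ⟨hL, hLinj⟩ => hinj ⟨hL.finite, (hL.moduleDepth_eq hR).ge, hLinj⟩⟩
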